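/- Let $E$ be a separable reflexive real Banach space with dual $E^*$ and duality pairing $\langle\cdot,\cdot\rangle$. Let $A:E\to E^*$ be continuous (for the norm topologies), bounded (it maps bounded sets to bounded sets) and coercive, i.e. $\langle A(u),u\rangle/\|u\|\to+\infty$ as $\|u\|\to+\infty$. Let $f\in E^*$ be arbitrary. Call $u\in E$ a generalized solution of the equation $A(u)=f$ if there is a sequence $(u_n)$ in $E$ such that (a) $u_n\rightharpoonup u$ weakly in $E$; (b) $\langle A(u_n)-f,v\rangle\to 0$ for every $v\in E$; (c) $\langle A(u_n)-f,u_n-u\rangle\to 0$; and call $u$ a weak solution if $A(u)=f$ in $E^*$. Then the equation $A(u)=f$ has at least one generalized solution. If, in addition, $A$ has property (S), i.e. for every sequence $(u_n)$ in $E$ and every $u_0\in E$ the relations $u_n\rightharpoonup u_0$ in $E$ and $\langle A(u_n),u_n-u_0\rangle\to 0$ imply $u_n\to u_0$ in norm, then every generalized solution of $A(u)=f$ is a weak solution. -/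

import Mathlib

open Filter Topology

/-- A normed space is reflexive if the canonical embedding into its bidual is onto. -/
def IsReflexiveSpace (E : Type*) [NormedAddCommGroup E] [NormedSpace ℝ E] : Prop :=
  Function.Surjective (NormedSpace.inclusionInDoubleDual ℝ E)

/-- Weak convergence `u n ⇀ u₀` of a sequence: convergence in the weak topology of `E`. -/
def WeaklyConverges {E : Type*} [NormedAddCommGroup E] [NormedSpace ℝ E]
    (u : ℕ → E) (u₀ : E) : Prop :=
  Tendsto (fun n => toWeakSpace ℝ E (u n)) atTop (𝓝 (toWeakSpace ℝ E u₀))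

/-- `A : E → E*` is bounded if it maps bounded sets to (norm-)bounded sets. -/
def IsBoundedOperator {E : Type*} [NormedAddCommGroup E] [NormedSpace ℝ E]
    (A : E → StrongDual ℝ E) : Prop :=
  ∀ s : Set E, Bornology.IsBounded s → Bornology.IsBounded (A '' s)

/-- `A : E → E*` is coercive if `⟨A u, u⟩ / ‖u‖ → +∞` as `‖u‖ → +∞`. -/
def IsCoerciveOperator {E : Type*} [NormedAddCommGroup E] [NormedSpace ℝ E]
    (A : E → StrongDual ℝ E) : Prop :=
  Tendsto (fun u : E => A u u / ‖u‖) (comap (fun u : E => ‖u‖) atTop) atTop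

/-- Property (S): `u n ⇀ u₀` and `⟨A (u n), u n - u₀⟩ → 0` imply `u n → u₀` in norm. -/
def HasPropertyS {E : Type*} [NormedAddCommGroup E] [NormedSpace ℝ E]
    (A : E → StrongDual ℝ E) : Prop :=
  ∀ (u : ℕ → E) (u₀ : E), WeaklyConverges u u₀ →
    Tendsto (fun n => A (u n) (u n - u₀)) atTop (𝓝 0) →
    Tendsto u atTop (𝓝 u₀)

/-- `u` is a generalized solution of the equation `A u = f`. -/
def IsGeneralizedSolution {E : Type*} [NormedAddCommGroup E] [NormedSpace ℝ E]
    (A : E → StrongDual ℝ E) (f : StrongDual ℝ E) (u : E) : Prop :=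
  ∃ w : ℕ → E, WeaklyConverges w u ∧
    (∀ v : E, Tendsto (fun n => (A (w n) - f) v) atTop (𝓝 0)) ∧
    Tendsto (fun n => (A (w n) - f) (w n - u)) atTop (𝓝 0)

/-- `u` is a weak solution of the equation: `A u = f` holds as an identity in `E*`. -/
def IsWeakSolution {E : Type*} [NormedAddCommGroup E] [NormedSpace ℝ E]
    (A : E → StrongDual ℝ E) (f : StrongDual ℝ E) (u : E) : Prop :=
  A u = f

/-! Galerkin's method. Coercivity makes ⟨A(u) - f, u⟩ positive for large ‖u‖, so the equation
restricted to each finite-dimensional span of a dense sequence has a solution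
(`exists_mem_forall_mem_apply_eq_zero`), and these solutions are uniformly bounded. Reflexivity and
separability give a weakly convergent subsequence; boundedness of A extends (b) from the dense
sequence to all of E, and (c) follows because each residual annihilates its own Galerkin solution.
Under (S) the convergence is strong, and continuity identifies the limit of A(u_n) with f.

The finite-dimensional input is a Brouwer-type theorem, obtained from the absence of a C¹ retraction
onto the sphere by comparing Jacobian integrals. -/

open MeasureTheory Metric Module

/-! ### Jacobian integrals and the no-retraction theorem -/

section Degree

variable {X : Type*} [NormedAddCommGroup X] [InnerProductSpace ℝ X] [FiniteDimensional ℝ X]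

/-- The function `t ↦ det (1 + t B)` is a polynomial of degree at most `dim X`, so its value at `1`
is a fixed affine combination of its values at small positive nodes. -/
theorem exists_det_one_add_eq_sum (X : Type*) [NormedAddCommGroup X] [InnerProductSpace ℝ X]
    [FiniteDimensional ℝ X] {δ : ℝ} (hδ : 0 < δ) :
    ∃ (s : Finset ℕ) (τ w : ℕ → ℝ), (∀ i ∈ s, 0 < τ i ∧ τ i < δ) ∧ ∑ i ∈ s, w i = 1 ∧
      ∀ B : X →L[ℝ] X, (1 + B).det = ∑ i ∈ s, w i * (1 + τ i • B).det := by
  classical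
  set n := finrank ℝ X
  set s := Finset.range (n + 1)
  -- The shift by 2 keeps every node, including i = 0, strictly below δ.
  set τ : ℕ → ℝ := fun i => δ / (i + 2)
  have hinj : Set.InjOn τ s := by
    intro i _ j _ hij
    have h1 : (i : ℝ) + 2 ≠ 0 := by positivity
    have h2 : (j : ℝ) + 2 ≠ 0 := by positivity
    simp only [τ] at hij
    field_simp at hij
    exact_mod_cast (add_right_cancel hij).symm
  have hs : s.Nonempty := ⟨0, by simp [s]⟩
  refine ⟨s, τ, fun i => (Lagrange.basis s τ i).eval 1, fun i _ => ⟨by positivity, ?_⟩, ?_,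
    fun B => ?_⟩
  · have : (1 : ℝ) < i + 2 := by have := Nat.cast_nonneg (α := ℝ) i; linarith
    exact div_lt_self hδ this
  · have := congrArg (Polynomial.eval (1 : ℝ)) (Lagrange.sum_basis hinj hs)
    simpa [Polynomial.eval_finsetSum] using this
  · let b := finBasis ℝ X
    set M := LinearMap.toMatrix b b (B : X →ₗ[ℝ] X)
    set p : Polynomial ℝ :=
      Matrix.det ((Polynomial.X : Polynomial ℝ) • M.map Polynomial.C
        + (1 : Matrix (Fin n) (Fin n) ℝ).map Polynomial.C)
    have hp : ∀ t : ℝ, p.eval t = (1 + t • B).det := by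
      intro t
      have h1 : (1 + t • B).det = Matrix.det (1 + t • M) := by
        rw [ContinuousLinearMap.det, ← LinearMap.det_toMatrix b]
        congr 1
        have : ((1 + t • B : X →L[ℝ] X) : X →ₗ[ℝ] X) = LinearMap.id + t • (B : X →ₗ[ℝ] X) := by
          ext; simp
        rw [this, map_add, map_smul, LinearMap.toMatrix_id]
      rw [h1, ← Polynomial.coe_evalRingHom, RingHom.map_det]
      congr 1
      ext i j
      by_cases hij : i = j <;> simp [hij, add_comm, mul_comm t]
    have hdeg : p.degree < s.card := by
      refine lt_of_le_of_lt Polynomial.degree_le_natDegree ?_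
      have := Polynomial.natDegree_det_X_add_C_le M 1
      rw [Fintype.card_fin] at this
      simp only [s, Finset.card_range]
      exact_mod_cast Nat.lt_succ_of_le this
    have h := congrArg (Polynomial.eval (1 : ℝ)) (Lagrange.eq_interpolate hinj hdeg)
    rw [hp, one_smul, Lagrange.interpolate_apply, Polynomial.eval_finsetSum] at h
    rw [h]
    refine Finset.sum_congr rfl fun i _ => ?_
    rw [Polynomial.eval_mul, Polynomial.eval_C, hp, mul_comm]

/-- A segment leaving the ball meets the sphere, where k vanishes; comparing with that point costs
no more than the length of the segment, so the constant L survives. -/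
theorem LipschitzOnWith.lipschitzWith_indicator_closedBall {F : Type*} [NormedAddCommGroup F]
    {V : Type*} [NormedAddCommGroup V] [NormedSpace ℝ V] {k : V → F} {R : ℝ} {L : NNReal}
    (hk : LipschitzOnWith L k (closedBall 0 R)) (h0 : ∀ x, ‖x‖ = R → k x = 0) :
    LipschitzWith L ((closedBall (0 : V) R).indicator k) := by
  have key : ∀ x ∈ closedBall (0 : V) R, ∀ y ∉ closedBall (0 : V) R,
      dist (k x) 0 ≤ L * dist x y := by
    intro x hx y hy
    rw [mem_closedBall_zero_iff] at hx hy
    obtain ⟨z, hz, hzR⟩ := (convex_segment (𝕜 := ℝ) x y).isPreconnected.intermediate_value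
      (left_mem_segment ℝ x y) (right_mem_segment ℝ x y) continuous_norm.continuousOn
      ⟨hx, (not_le.1 hy).le⟩
    have h1 := hk.dist_le_mul x (by simpa using hx) z (by simpa using hzR.le)
    rw [h0 z hzR] at h1
    have h2 := dist_add_dist_of_mem_segment hz
    exact h1.trans (by gcongr; linarith [dist_nonneg (x := z) (y := y)])
  refine LipschitzWith.of_dist_le_mul fun x y => ?_
  by_cases hx : x ∈ closedBall (0 : V) R <;> by_cases hy : y ∈ closedBall (0 : V) R
  · simpa [hx, hy] using hk.dist_le_mul x hx y hy
  · rw [Set.indicator_of_mem hx, Set.indicator_of_notMem hy]; exact key x hx y hy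
  · rw [Set.indicator_of_notMem hx, Set.indicator_of_mem hy, dist_comm, dist_comm x]
    exact key y hy x hx
  · rw [Set.indicator_of_notMem hx, Set.indicator_of_notMem hy, dist_self]; positivity

/-- A small Lipschitz perturbation of the identity is bijective. -/
theorem LipschitzWith.bijective_add_smul {V : Type*} [NormedAddCommGroup V] [NormedSpace ℝ V]
    [CompleteSpace V] {K : V → V} {L : NNReal} (hK : LipschitzWith L K) {t : ℝ} (ht : 0 ≤ t)
    (htL : t * L < 1) : Function.Bijective fun x => x + t • K x := by
  have hc : ∀ y : V, ContractingWith (t.toNNReal * L) fun x => y - t • K x := by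
    refine fun y => ⟨?_, LipschitzWith.of_dist_le_mul ?_⟩
    · rw [← NNReal.coe_lt_coe, NNReal.coe_mul, Real.coe_toNNReal t ht]
      exact htL
    · intro a b
      rw [dist_sub_left, dist_smul₀, Real.norm_of_nonneg ht, NNReal.coe_mul,
        Real.coe_toNNReal t ht, mul_assoc]
      gcongr
      exact hK.dist_le_mul a b
  constructor
  · intro a b hab
    refine (hc (a + t • K a)).fixedPoint_unique' ?_ ?_
    · simp [Function.IsFixedPt]
    · simp only at hab
      simp [Function.IsFixedPt, hab]
  · intro y
    refine ⟨(hc y).fixedPoint, ?_⟩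
    have := (hc y).fixedPoint_isFixedPt
    rw [Function.IsFixedPt, sub_eq_iff_eq_add] at this
    exact this.symm

/-- A `C¹` map of a closed ball which is the identity on the boundary sphere has the same Jacobian
integral as the identity. -/
theorem setIntegral_det_fderiv_eq_volume_ball [MeasurableSpace X] [BorelSpace X] {F : X → X} {R : ℝ}
    (hF : ∀ x ∈ closedBall (0 : X) R, ContDiffAt ℝ 1 F x) (hFR : ∀ x, ‖x‖ = R → F x = x) :
    ∫ x in ball (0 : X) R, (fderiv ℝ F x).det = volume.real (ball (0 : X) R) := by
  set k : X → X := fun x => F x - x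
  have hk : ∀ x ∈ closedBall (0 : X) R, ContDiffAt ℝ 1 k x := fun x hx =>
    (hF x hx).sub contDiffAt_id
  have hk' : ContinuousOn (fderiv ℝ k) (closedBall 0 R) := fun x hx =>
    ((hk x hx).fderiv_right (m := 0) (by simp)).continuousAt.continuousWithinAt
  have hdk : ∀ x ∈ closedBall (0 : X) R, HasFDerivAt k (fderiv ℝ k x) x := fun x hx =>
    ((hk x hx).differentiableAt (by simp)).hasFDerivAt
  obtain ⟨C, hC⟩ := (isCompact_closedBall (0 : X) R).exists_bound_of_continuousOn hk'
  set L : NNReal := C.toNNReal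
  have hL : ∀ x ∈ closedBall (0 : X) R, ‖fderiv ℝ k x‖ ≤ L := fun x hx =>
    (hC x hx).trans (Real.le_coe_toNNReal C)
  have hlip : LipschitzOnWith L k (closedBall 0 R) :=
    (convex_closedBall (0 : X) R).lipschitzOnWith_of_nnnorm_fderiv_le
      (fun x hx => (hdk x hx).differentiableAt) fun x hx => hL x hx
  have hK := hlip.lipschitzWith_indicator_closedBall (fun x hx => by simp [k, hFR x hx])
  set K := (closedBall (0 : X) R).indicator k
  have hdet0 : ∀ᶠ S : X →L[ℝ] X in 𝓝 0, 0 < (1 + S).det := by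
    have hc : Continuous fun S : X →L[ℝ] X => (1 + S).det :=
      ContinuousLinearMap.continuous_det.comp (continuous_const.add continuous_id)
    refine hc.continuousAt.eventually (lt_mem_nhds (a := (0 : ℝ)) ?_)
    simp [ContinuousLinearMap.det]
  obtain ⟨ε, hε, hdet⟩ := Metric.eventually_nhds_iff.1 hdet0
  have hL1 : (0 : ℝ) < L + 1 := by positivity
  -- This δ makes τ L < 1, so the perturbed identity is bijective, and τ L < ε, so its Jacobian is
  -- positive.
  obtain ⟨s, τ, w, hτ, hw, hsum⟩ :=
    exists_det_one_add_eq_sum X (δ := min 1 ε / (L + 1)) (by positivity)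
  have hτL : ∀ i ∈ s, τ i * L < min 1 ε := fun i hi => by
    have h1 := (lt_div_iff₀ hL1).1 (hτ i hi).2
    nlinarith [(hτ i hi).1]
  have hsmall : ∀ i ∈ s,
      ∫ x in ball (0 : X) R, (1 + τ i • fderiv ℝ k x).det = volume.real (ball (0 : X) R) := by
    intro i hi
    have hbij := hK.bijective_add_smul (hτ i hi).1.le ((hτL i hi).trans_le (min_le_left _ _))
    set h : X → X := fun x => x + τ i • K x
    have hout : ∀ x ∉ ball (0 : X) R, h x = x := by
      intro x hx
      have : K x = 0 := by
        by_cases hx' : x ∈ closedBall (0 : X) R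
        · simp only [K, Set.indicator_of_mem hx', k]
          rw [hFR x, sub_self]
          simp only [mem_ball_zero_iff, not_lt, mem_closedBall_zero_iff] at hx hx'
          exact le_antisymm hx' hx
        · exact Set.indicator_of_notMem hx' _
      simp [h, this]
    -- A bijection fixing the complement of the ball pointwise maps the ball onto itself.
    have himg : h '' ball (0 : X) R = ball 0 R := by
      have h1 : h '' (ball (0 : X) R)ᶜ = (ball 0 R)ᶜ := by
        exact (Set.image_congr hout).trans (Set.image_id' _)
      rw [← compl_inj_iff, ← h1, Set.image_compl_eq hbij]
    have hder : ∀ x ∈ ball (0 : X) R,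
        HasFDerivWithinAt h (1 + τ i • fderiv ℝ k x) (ball 0 R) x := by
      intro x hx
      have h1 : HasFDerivAt (fun x => x + τ i • k x) (1 + τ i • fderiv ℝ k x) x :=
        (hasFDerivAt_id x).add ((hdk x (ball_subset_closedBall hx)).const_smul (τ i))
      refine h1.hasFDerivWithinAt.congr (fun y hy => ?_) ?_
      · simp [h, K, Set.indicator_of_mem (ball_subset_closedBall hy)]
      · simp [h, K, Set.indicator_of_mem (ball_subset_closedBall hx)]
    have hcov := integral_image_eq_integral_abs_det_fderiv_smul volume measurableSet_ball hder
      hbij.1.injOn (fun _ => (1 : ℝ))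
    rw [himg] at hcov
    simp only [smul_eq_mul, mul_one, integral_const, MeasurableSet.univ,
      measureReal_restrict_apply, Set.univ_inter] at hcov
    rw [hcov]
    refine setIntegral_congr_fun measurableSet_ball fun x hx => ?_
    refine (abs_of_pos (hdet ?_)).symm
    rw [dist_zero_right, norm_smul, Real.norm_of_nonneg (hτ i hi).1.le]
    calc τ i * ‖fderiv ℝ k x‖ ≤ τ i * L := by
          gcongr
          · exact (hτ i hi).1.le
          · exact hL x (ball_subset_closedBall hx)
      _ < ε := (hτL i hi).trans_le (min_le_right _ _)
  have hint : ∀ t : ℝ, IntegrableOn (fun x => (1 + t • fderiv ℝ k x).det) (ball (0 : X) R) := by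
    intro t
    refine IntegrableOn.mono_set (ContinuousOn.integrableOn_compact (isCompact_closedBall 0 R) ?_)
      ball_subset_closedBall
    exact ContinuousLinearMap.continuous_det.comp_continuousOn
      (continuousOn_const.add (hk'.const_smul t))
  calc ∫ x in ball (0 : X) R, (fderiv ℝ F x).det
      = ∫ x in ball (0 : X) R, ∑ i ∈ s, w i * (1 + τ i • fderiv ℝ k x).det := by
        refine setIntegral_congr_fun measurableSet_ball fun x hx => ?_
        rw [← hsum]
        congr 1
        have : fderiv ℝ k x = fderiv ℝ F x - 1 :=
          (((hF x (ball_subset_closedBall hx)).differentiableAt (by simp)).hasFDerivAt.sub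
            (hasFDerivAt_id x)).fderiv
        rw [this]; abel
    _ = ∑ i ∈ s, w i * ∫ x in ball (0 : X) R, (1 + τ i • fderiv ℝ k x).det := by
        rw [integral_finsetSum _ fun i _ => (hint (τ i)).const_mul (w i)]
        exact Finset.sum_congr rfl fun i _ => integral_const_mul _ _
    _ = volume.real (ball (0 : X) R) := by
        rw [Finset.sum_congr rfl fun i hi => by rw [hsmall i hi], ← Finset.sum_mul, hw, one_mul]

/-- There is no `C¹` retraction of a ball onto its boundary sphere. -/
theorem not_contDiffAt_retraction_sphere {F : X → X} {R : ℝ} (hR : 0 < R)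
    (hF : ∀ x ∈ closedBall (0 : X) R, ContDiffAt ℝ 1 F x) (hFR : ∀ x, ‖x‖ = R → F x = x)
    (hnorm : ∀ x ∈ ball (0 : X) R, ‖F x‖ = R) : False := by
  let : MeasurableSpace X := borel X
  have : BorelSpace X := ⟨rfl⟩
  have hdet : ∀ x ∈ ball (0 : X) R, (fderiv ℝ F x).det = 0 := by
    intro x hx
    by_contra hne
    have hd := ((hF x (ball_subset_closedBall hx)).differentiableAt (by simp)).hasFDerivAt
    have h1 := hd.inner ℝ hd
    have h2 : (fun y => inner ℝ (F y) (F y)) =ᶠ[𝓝 x] fun _ => R ^ 2 := by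
      filter_upwards [isOpen_ball.mem_nhds hx] with y hy
      rw [real_inner_self_eq_norm_sq, hnorm y hy]
    have h3 := h1.unique ((hasFDerivAt_const (R ^ 2) x).congr_of_eventuallyEq h2)
    -- Solve F'(x) v = F x; differentiating the constant ‖F‖² along v then gives 2R² = 0.
    obtain ⟨v, hv⟩ := (LinearMap.equivOfDetNeZero (fderiv ℝ F x : X →ₗ[ℝ] X) hne).surjective (F x)
    have hv' : fderiv ℝ F x v = F x := hv
    have h4 := DFunLike.congr_fun h3 v
    simp [fderivInnerCLM_apply, hv', hnorm x hx] at h4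
    exact hR.ne' h4
  have h := setIntegral_det_fderiv_eq_volume_ball hF hFR
  rw [setIntegral_congr_fun measurableSet_ball hdet, integral_zero] at h
  have hpos : 0 < volume.real (ball (0 : X) R) :=
    ENNReal.toReal_pos (measure_ball_pos _ _ hR).ne' measure_ball_lt_top.ne
  exact hpos.ne h

end Degree

/-! ### Zeros of outward-pointing fields and the Galerkin equation -/

open scoped Manifold ContDiff in
/-- A continuous nowhere vanishing field pointing outwards far away can be replaced by a smooth
one. -/
theorem exists_contDiff_ne_zero_inner_pos {X : Type*} [NormedAddCommGroup X]
    [InnerProductSpace ℝ X] [FiniteDimensional ℝ X] {g : X → X} (hg : Continuous g) {R : ℝ}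
    (hne : ∀ x, g x ≠ 0) (hpos : ∀ x, R ≤ ‖x‖ → 0 < inner ℝ x (g x)) :
    ∃ v : X → X, ContDiff ℝ 1 v ∧ (∀ x, v x ≠ 0) ∧ ∀ x, R ≤ ‖x‖ → 0 < inner ℝ x (v x) := by
  -- Both conditions are convex in v and hold near x for the constant g x, so a partition of unity
  -- glues. Positivity against g y forces v y ≠ 0.
  obtain ⟨v, hv⟩ := exists_contMDiffMap_forall_mem_convex_of_local_const (n := 1) 𝓘(ℝ, X)
    (F := X) (t := fun y => {v | 0 < inner ℝ (g y) v ∧ (R ≤ ‖y‖ → 0 < inner ℝ y v)})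
    (fun y => by
      intro a ha b hb p q hp hq hpq
      have key : ∀ z : X, 0 < inner ℝ z a → 0 < inner ℝ z b → 0 < inner ℝ z (p • a + q • b) := by
        intro z hza hzb
        rw [inner_add_right, inner_smul_right, inner_smul_right]
        rcases hp.eq_or_lt with rfl | hp
        · simp_all
        · positivity
      exact ⟨key _ ha.1 hb.1, fun h => key _ (ha.2 h) (hb.2 h)⟩)
    (fun x => ⟨g x, by
      have h1 : ∀ᶠ y in 𝓝 x, 0 < inner ℝ (g y) (g x) := by
        have hc : Continuous fun y => inner ℝ (g y) (g x) := by fun_prop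
        exact hc.continuousAt.eventually (lt_mem_nhds (real_inner_self_pos.2 (hne x)))
      have h2 : ∀ᶠ y in 𝓝 x, R ≤ ‖y‖ → 0 < inner ℝ y (g x) := by
        rcases le_or_gt R ‖x‖ with hx | hx
        · have hc : Continuous fun y => inner ℝ y (g x) := by fun_prop
          filter_upwards [hc.continuousAt.eventually (lt_mem_nhds (hpos x hx))] with y hy _
          exact hy
        · filter_upwards [continuous_norm.continuousAt.eventually (gt_mem_nhds hx)] with y hy h
          exact absurd h (not_le.2 hy)
      filter_upwards [h1, h2] with y hy1 hy2
      exact ⟨hy1, hy2⟩⟩)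
  refine ⟨v, v.contMDiff.contDiff, fun x hx => ?_, fun x hx => (hv x).2 hx⟩
  have := (hv x).1
  rw [hx, inner_zero_right] at this
  exact this.false

/-- A continuous field on a Euclidean space pointing outwards far away has a zero. -/
theorem exists_eq_zero_of_inner_pos {X : Type*} [NormedAddCommGroup X]
    [InnerProductSpace ℝ X] [FiniteDimensional ℝ X] {g : X → X} (hg : Continuous g) {R : ℝ}
    (hR : 0 < R) (hpos : ∀ x, R ≤ ‖x‖ → 0 < inner ℝ x (g x)) : ∃ x, g x = 0 := by
  by_contra! hne
  obtain ⟨v, hv, hv0, hvpos⟩ := exists_contDiff_ne_zero_inner_pos hg hne hpos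
  let φ : ContDiffBump (0 : X) := ⟨R, 2 * R, hR, by linarith⟩
  -- Deform v to the identity on the shell R ≤ ‖x‖ ≤ 2R. There both fields point outwards, so no
  -- zero appears, and normalizing G gives a forbidden retraction.
  set G : X → X := fun x => φ x • v x + (1 - φ x) • x
  have hG : ContDiff ℝ 1 G := by
    have := φ.contDiff (n := 1)
    fun_prop
  have hG0 : ∀ x, G x ≠ 0 := by
    intro x h0
    rcases le_or_gt ‖x‖ R with hx | hx
    · have : φ x = 1 := φ.one_of_mem_closedBall (by simpa [φ] using hx)
      simp [G, this, hv0] at h0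
    · have h1 : 0 < inner ℝ x (G x) := by
        simp only [G, inner_add_right, inner_smul_right, real_inner_self_eq_norm_sq]
        have h2 := hvpos x hx.le
        have h3 : 0 < ‖x‖ ^ 2 := by have := hR.trans hx; positivity
        rcases (φ.nonneg' x).eq_or_lt with h | h
        · rw [← h]; simpa using h3
        · have := mul_nonneg (sub_nonneg.2 (φ.le_one (x := x))) h3.le
          positivity
      rw [h0, inner_zero_right] at h1
      exact h1.false
  have hout : ∀ x, ‖x‖ = 2 * R → G x = x := by
    intro x hx
    have : φ x = 0 := φ.zero_of_le_dist (by simp [φ, hx])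
    simp [G, this]
  refine not_contDiffAt_retraction_sphere (F := fun x => (2 * R / ‖G x‖) • G x) (R := 2 * R)
    (by linarith) (fun x _ => ?_) (fun x hx => ?_) (fun x _ => ?_)
  · exact ((contDiff_const.div (hG.norm ℝ hG0) fun x => norm_ne_zero_iff.2 (hG0 x)).smul
      hG).contDiffAt
  · rw [hout x hx, hx, div_self (by linarith), one_smul]
  · rw [norm_smul, norm_div, norm_norm, div_mul_cancel₀ _ (norm_ne_zero_iff.2 (hG0 x)),
      Real.norm_of_nonneg (by linarith)]

/-- A continuous map from a finite-dimensional normed space to its dual which is positive on large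
vectors has a zero. -/
theorem exists_eq_zero_of_apply_self_pos {V : Type*} [NormedAddCommGroup V] [NormedSpace ℝ V]
    [FiniteDimensional ℝ V] {T : V → StrongDual ℝ V} (hT : Continuous T) {R : ℝ}
    (hpos : ∀ x, R ≤ ‖x‖ → 0 < T x x) : ∃ x, T x = 0 := by
  let e : EuclideanSpace ℝ (Fin (finrank ℝ V)) ≃L[ℝ] V :=
    ContinuousLinearEquiv.ofFinrankEq (by simp)
  let D := InnerProductSpace.toDual ℝ (EuclideanSpace ℝ (Fin (finrank ℝ V)))
  let g : EuclideanSpace ℝ (Fin (finrank ℝ V)) → EuclideanSpace ℝ (Fin (finrank ℝ V)) := fun x =>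
    D.symm ((T (e x)).comp (e : EuclideanSpace ℝ (Fin (finrank ℝ V)) →L[ℝ] V))
  have hg : Continuous g :=
    D.symm.continuous.comp ((hT.comp e.continuous).clm_comp continuous_const)
  have hinner : ∀ x y, inner ℝ y (g x) = T (e x) (e y) := by
    intro x y
    rw [real_inner_comm, InnerProductSpace.toDual_symm_apply]
    rfl
  obtain ⟨C, hC⟩ : ∃ C, ∀ x, ‖x‖ ≤ C * ‖e x‖ := by
    refine ⟨‖(e.symm : V →L[ℝ] EuclideanSpace ℝ (Fin (finrank ℝ V)))‖, fun x => ?_⟩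
    simpa using (e.symm : V →L[ℝ] EuclideanSpace ℝ (Fin (finrank ℝ V))).le_opNorm (e x)
  have hCpos : 0 < max C 1 := by positivity
  -- As e need not be an isometry, the radius is scaled by C so that ‖e x‖ ≥ R.
  obtain ⟨x, hx⟩ := exists_eq_zero_of_inner_pos hg (R := max C 1 * max R 1) (by positivity)
    (fun x hx => by
      rw [hinner]
      refine hpos _ ((le_max_left R 1).trans ?_)
      refine le_of_mul_le_mul_left (hx.trans ((hC x).trans ?_)) hCpos
      gcongr
      exact le_max_left _ _)
  refine ⟨e x, ContinuousLinearMap.ext fun v => ?_⟩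
  have := hinner x (e.symm v)
  rw [hx, inner_zero_right, e.apply_symm_apply] at this
  exact this.symm

/-- The Galerkin equation: a coercive-type map has a solution on each finite-dimensional
subspace. -/
theorem exists_mem_forall_mem_apply_eq_zero {E : Type*} [NormedAddCommGroup E] [NormedSpace ℝ E]
    {T : E → StrongDual ℝ E} (hT : Continuous T) {R : ℝ} (hpos : ∀ x, R ≤ ‖x‖ → 0 < T x x)
    (V : Submodule ℝ E) [FiniteDimensional ℝ V] : ∃ u ∈ V, ∀ v ∈ V, T u v = 0 := by
  obtain ⟨x, hx⟩ := exists_eq_zero_of_apply_self_pos (V := V)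
    (T := fun x => (T x).comp V.subtypeL)
    ((hT.comp continuous_subtype_val).clm_comp continuous_const) (R := R)
    (fun x hx => hpos x hx)
  exact ⟨x, x.2, fun v hv => DFunLike.congr_fun hx (⟨v, hv⟩ : V)⟩

/-! ### Weak compactness and passage to the limit -/

/-- In a separable normed space countably many continuous functionals separate points. -/
theorem exists_seq_strongDual_separating (E : Type*) [NormedAddCommGroup E] [NormedSpace ℝ E]
    [TopologicalSpace.SeparableSpace E] :
    ∃ g : ℕ → StrongDual ℝ E, ∀ z, (∀ n, g n z = 0) → z = 0 := by
  choose g hg1 hg2 using fun n => exists_dual_vector'' ℝ (TopologicalSpace.denseSeq E n)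
  refine ⟨g, fun z hz => ?_⟩
  by_contra hne
  have hz' : 0 < ‖z‖ := norm_pos_iff.2 hne
  obtain ⟨n, hn⟩ := (TopologicalSpace.denseRange_denseSeq E).exists_dist_lt z (half_pos hz')
  set d := TopologicalSpace.denseSeq E n
  have h1 : ‖d‖ ≤ dist z d := by
    have h2 : g n (d - z) = ‖d‖ := by rw [map_sub, hz n, sub_zero, hg2]; rfl
    rw [dist_comm, dist_eq_norm]
    calc ‖d‖ = g n (d - z) := h2.symm
      _ ≤ ‖g n (d - z)‖ := le_abs_self _
      _ ≤ 1 * ‖d - z‖ := (g n).le_of_opNorm_le (hg1 n) _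
      _ = ‖d - z‖ := one_mul _
  have h3 : ‖z‖ ≤ dist z d + ‖d‖ := by
    rw [dist_eq_norm]; simpa using norm_add_le (z - d) d
  linarith

theorem weaklyConverges_iff {E : Type*} [NormedAddCommGroup E] [NormedSpace ℝ E]
    {u : ℕ → E} {u₀ : E} :
    WeaklyConverges u u₀ ↔ ∀ f : StrongDual ℝ E, Tendsto (fun n => f (u n)) atTop (𝓝 (f u₀)) :=
  WeakBilin.tendsto_iff_forall_eval_tendsto _
    fun _ _ h => (SeparatingDual.eq_iff_forall_dual_eq (R := ℝ)).2 fun g => DFunLike.congr_fun h g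

/-- Bounded sequences in a separable reflexive space have weakly convergent subsequences. -/
theorem IsReflexiveSpace.exists_subseq_weaklyConverges {E : Type*} [NormedAddCommGroup E]
    [NormedSpace ℝ E] [TopologicalSpace.SeparableSpace E] (hE : IsReflexiveSpace E)
    {u : ℕ → E} (hu : Bornology.IsBounded (Set.range u)) :
    ∃ (u₀ : E) (φ : ℕ → ℕ), StrictMono φ ∧ WeaklyConverges (u ∘ φ) u₀ := by
  set S : Set (WeakSpace ℝ E) := toWeakSpace ℝ E '' Set.range u
  have hS : IsCompact (closure S) := by
    refine NormedSpace.isCompact_closure_of_isBounded ℝ E S ?_ ?_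
    · rwa [Set.preimage_image_eq _ (toWeakSpace ℝ E).injective]
    · intro y _
      obtain ⟨x, hx⟩ := hE (WeakDual.toStrongDual y)
      exact ⟨toWeakSpace ℝ E x, DFunLike.ext _ _ fun f => DFunLike.congr_fun hx f⟩
  obtain ⟨g, hg⟩ := exists_seq_strongDual_separating E
  have : CompactSpace (closure S) := isCompact_iff_compactSpace.1 hS
  -- A compact space with countably many separating continuous functions is metrizable, hence
  -- sequentially compact.
  have : TopologicalSpace.MetrizableSpace (closure S) :=
    Metric.PiNatEmbed.TopologicalSpace.MetrizableSpace.of_countable_separating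
      (fun n (k : closure S) => g n ((toWeakSpace ℝ E).symm k))
      (fun n => (WeakBilin.eval_continuous (topDualPairing ℝ E).flip (g n)).comp
        continuous_subtype_val)
      (fun x y hxy => by
        contrapose! hxy
        refine Subtype.ext ((toWeakSpace ℝ E).symm.injective (sub_eq_zero.1 (hg _ fun n => ?_)))
        rw [map_sub, hxy n, sub_self])
  let w : ℕ → closure S := fun n =>
    ⟨toWeakSpace ℝ E (u n), subset_closure ⟨u n, ⟨n, rfl⟩, rfl⟩⟩
  obtain ⟨a, φ, hφ, ha⟩ := CompactSpace.tendsto_subseq w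
  refine ⟨(toWeakSpace ℝ E).symm a, φ, hφ, ?_⟩
  rw [WeaklyConverges, LinearEquiv.apply_symm_apply]
  exact (continuous_subtype_val.tendsto a).comp ha

/-- Pointwise convergence to zero of a bounded sequence of functionals may be checked on a dense
set. -/
theorem tendsto_apply_zero_of_dense {E : Type*} [NormedAddCommGroup E] [NormedSpace ℝ E]
    {T : ℕ → StrongDual ℝ E} {C : ℝ} (hC : ∀ n, ‖T n‖ ≤ C) {s : Set E} (hs : Dense s)
    (h : ∀ v ∈ s, Tendsto (fun n => T n v) atTop (𝓝 0)) (v : E) :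
    Tendsto (fun n => T n v) atTop (𝓝 0) := by
  have hC0 : 0 ≤ C := (norm_nonneg _).trans (hC 0)
  rw [Metric.tendsto_atTop]
  intro ε hε
  obtain ⟨d, hd, hvd⟩ := hs.exists_dist_lt v (show 0 < ε / (2 * (C + 1)) by positivity)
  obtain ⟨N, hN⟩ := Metric.tendsto_atTop.1 (h d hd) (ε / 2) (by positivity)
  refine ⟨N, fun n hn => ?_⟩
  have h1 := hN n hn
  rw [dist_zero_right] at h1 ⊢
  have h2 : ‖T n (v - d)‖ ≤ ε / 2 := by
    refine ((T n).le_of_opNorm_le (hC n) _).trans ?_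
    rw [dist_eq_norm] at hvd
    rw [lt_div_iff₀ (by positivity)] at hvd
    nlinarith [norm_nonneg (v - d)]
  calc ‖T n v‖ = ‖T n (v - d) + T n d‖ := by rw [← map_add, sub_add_cancel]
    _ ≤ ‖T n (v - d)‖ + ‖T n d‖ := norm_add_le _ _
    _ < ε := by linarith

theorem IsCoerciveOperator.exists_forall_sub_apply_self_pos {E : Type*} [NormedAddCommGroup E]
    [NormedSpace ℝ E] {A : E → StrongDual ℝ E} (hA : IsCoerciveOperator A) (f : StrongDual ℝ E) :
    ∃ R : ℝ, ∀ u, R ≤ ‖u‖ → 0 < (A u - f) u := by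
  have h := hA.eventually (eventually_gt_atTop ‖f‖)
  rw [eventually_comap] at h
  obtain ⟨R, hR⟩ := eventually_atTop.1 h
  refine ⟨max R 1, fun u hu => ?_⟩
  have hu0 : 0 < ‖u‖ := lt_of_lt_of_le one_pos ((le_max_right _ _).trans hu)
  have h1 := (lt_div_iff₀ hu0).1 (hR ‖u‖ ((le_max_left _ _).trans hu) u rfl)
  have h2 := (le_abs_self _).trans (f.le_opNorm u)
  simp only [sub_apply]
  linarith

theorem exists_isGeneralizedSolution {E : Type*} [NormedAddCommGroup E] [NormedSpace ℝ E]
    [TopologicalSpace.SeparableSpace E] (hE : IsReflexiveSpace E)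
    {A : E → StrongDual ℝ E} (hcont : Continuous A) (hcoer : IsCoerciveOperator A)
    (hbdd : IsBoundedOperator A) (f : StrongDual ℝ E) : ∃ u : E, IsGeneralizedSolution A f u := by
  obtain ⟨R, hR⟩ := hcoer.exists_forall_sub_apply_self_pos f
  let d := TopologicalSpace.denseSeq E
  let V : ℕ → Submodule ℝ E := fun n => Submodule.span ℝ (d '' Set.Iio n)
  have hV : ∀ n, FiniteDimensional ℝ (V n) := fun n =>
    FiniteDimensional.span_of_finite ℝ ((Set.finite_Iio n).image d)
  choose u huV hu using fun n =>
    exists_mem_forall_mem_apply_eq_zero (hcont.sub continuous_const) hR (V n)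
  have hnorm : ∀ n, ‖u n‖ ≤ R := fun n => by
    by_contra! h
    exact (hR (u n) h.le).ne' (hu n _ (huV n))
  have hub : Bornology.IsBounded (Set.range u) :=
    isBounded_iff_forall_norm_le.2 ⟨R, by rintro _ ⟨n, rfl⟩; exact hnorm n⟩
  obtain ⟨M, hM⟩ := isBounded_iff_forall_norm_le.1 (hbdd _ hub)
  obtain ⟨u₀, φ, hφ, hconv⟩ := hE.exists_subseq_weaklyConverges hub
  have hweak : ∀ v, Tendsto (fun n => (A (u (φ n)) - f) v) atTop (𝓝 0) := by
    refine tendsto_apply_zero_of_dense (C := M + ‖f‖)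
      (fun n => (norm_sub_le _ _).trans (by gcongr; exact hM _ ⟨_, ⟨φ n, rfl⟩, rfl⟩))
      (TopologicalSpace.denseRange_denseSeq E) ?_
    rintro _ ⟨m, rfl⟩
    -- The m-th dense vector lies in `V (φ n)` once n > m, so the residual vanishes on it from then
    -- on.
    refine tendsto_const_nhds.congr' ?_
    filter_upwards [eventually_gt_atTop m] with n hn
    exact (hu (φ n) _ (Submodule.subset_span ⟨m, hn.trans_le (hφ.id_le n), rfl⟩)).symm
  -- By the Galerkin equation tested with its own solution, (c) is minus (b) at v = u₀.
  refine ⟨u₀, u ∘ φ, hconv, hweak, ?_⟩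
  have h := (hweak u₀).neg
  rw [neg_zero] at h
  refine h.congr fun n => ?_
  have h0 : (A (u (φ n)) - f) (u (φ n)) = 0 := hu (φ n) _ (huV (φ n))
  rw [Function.comp_apply, map_sub, h0, zero_sub]

theorem IsGeneralizedSolution.isWeakSolution {E : Type*} [NormedAddCommGroup E] [NormedSpace ℝ E]
    {A : E → StrongDual ℝ E} (hcont : Continuous A) {f : StrongDual ℝ E} (hS : HasPropertyS A)
    {u : E} (hu : IsGeneralizedSolution A f u) : IsWeakSolution A f u := by
  obtain ⟨w, hw, hwv, hwu⟩ := hu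
  have hf : Tendsto (fun n => f (w n - u)) atTop (𝓝 0) := by
    have := (weaklyConverges_iff.1 hw f).sub_const (f u)
    simpa using this
  have hA : Tendsto (fun n => A (w n) (w n - u)) atTop (𝓝 0) := by
    have := hwu.add hf
    simpa using this
  have hAw := (hcont.tendsto u).comp (hS w u hw hA)
  refine ContinuousLinearMap.ext fun v => sub_eq_zero.1 (tendsto_nhds_unique ?_ (hwv v))
  exact ((ContinuousLinearMap.apply ℝ ℝ v).continuous.tendsto _).comp (hAw.sub_const f)

theorem mainTheorem1 {E : Type*} [NormedAddCommGroup E] [NormedSpace ℝ E] [CompleteSpace E]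
    [TopologicalSpace.SeparableSpace E] (hE : IsReflexiveSpace E)
    (A : E → StrongDual ℝ E) (hcont : Continuous A) (hcoer : IsCoerciveOperator A)
    (hbdd : IsBoundedOperator A) (f : StrongDual ℝ E) :
    (∃ u : E, IsGeneralizedSolution A f u) ∧
      (HasPropertyS A → ∀ u : E, IsGeneralizedSolution A f u → IsWeakSolution A f u) :=
  ⟨exists_isGeneralizedSolution hE hcont hcoer hbdd f,
    fun hS _ hu => hu.isWeakSolution hcont hS⟩
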